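/- Let $(\mathcal K,\prec_{\mathcal K})$ be an abstract elementary class in a (one-sorted) finitary signature, with the amalgamation and joint embedding properties, and let $\mathrm{LS}(\mathcal K)$ be its Löwenheim–Skolem number: the least infinite cardinal $\kappa$ such that for all $M\in\mathcal K$ and $A\subseteq M$ there is $M_0\prec_{\mathcal K}M$ with $A\subseteq M_0$ and $|M_0|\le|A|+\kappa$. For $M\in\mathcal K$, let $\text{ga-S}(M)$ be the set of Galois types over $M$: points $a\in N$ and $a'\in N'$ in strong extensions $N,N'$ of $M$ have the same Galois type over $M$ if there are $P\in\mathcal K$ and strong embeddings $N\to P$, $N'\to P$ that agree on $M$ and send $a$ and $a'$ to the same element (equivalently, inside a monster model $\mathfrak C$, $a$ and $a'$ are in the same orbit of $\mathrm{Aut}_M(\mathfrak C)$). If $N\prec_{\mathcal K}M$, $q\upharpoonright N$ is the restriction of $q\in\text{ga-S}(M)$ to $N$, and $q$ is then called an extension of $q\upharpoonright N$. Let $\mathrm{Sub}_{\le\kappa}(M)$ be the set of all $N\prec_{\mathcal K}M$ with $|N|\le\kappa$. $\mathcal K$ is $\chi$-tame if for all $M\in\mathcal K$ and distinct $p,p'\in\text{ga-S}(M)$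 there is $N\in\mathrm{Sub}_{\le\chi}(M)$ with $p\upharpoonright N\ne p'\upharpoonright N$. $\mathcal K$ is $\lambda$-stable if $|\text{ga-S}(M)|=\lambda$ for every $M\in\mathcal K$ with $|M|=\lambda$. For $\lambda\ge\mathrm{LS}(\mathcal K)$, the rank $\mathrm{RM}^\lambda$ (an ordinal or $\infty$) of $q\in\text{ga-S}(M)$ with $|M|\le\lambda$ is defined by: $\mathrm{RM}^\lambda[q]\ge0$ always; $\mathrm{RM}^\lambda[q]\ge\alpha$ for limit $\alpha$ if $\mathrm{RM}^\lambda[q]\ge\beta$ for all $\beta<\alpha$; $\mathrm{RM}^\lambda[q]\ge\alpha+1$ if there is $M'\succ_{\mathcal K}M$ such that $q$ has strictly more than $\lambda$ extensions $q'\in\text{ga-S}(M')$ with $\mathrm{RM}^\lambda[q'\upharpoonright N]\ge\alpha$ for all $N\in\mathrm{Sub}_{\le\lambda}(M')$. For $q\in\text{ga-S}(M)$ with $M$ of arbitrary size, $\mathrm{RM}^\lambda[q]=\min\{\mathrm{RM}^\lambda[q\upharpoonright N]: N\in\mathrm{Sub}_{\le\lambda}(M)\}$. $\mathcal K$ is $\lambda$-totally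 transcendental if $\mathrm{RM}^\lambda[q]$ is an ordinal for every $M\in\mathcal K$ and every $q\in\text{ga-S}(M)$. **Theorem 4.4.** If $\mathcal K$ is $\chi$-tame for some $\chi\ge\mathrm{LS}(\mathcal K)$, and is $\lambda$-stable with $\lambda\ge\chi$ and $\lambda^{\aleph_0}>\lambda$, then $\mathcal K$ is $\lambda$-totally transcendental. -/

import Mathlib

open Cardinal

universe u

namespace FirstOrder.Language

variable {L : FirstOrder.Language.{u, u}}

/-- For substructures `S ≤ T` of `X`, the substructure `S` regarded as a substructure of `T`. -/
def Substructure.within {X : Type u} [L.Structure X] (S T : L.Substructure X) :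
    L.Substructure T :=
  S.comap T.subtype.toHom

end FirstOrder.Language

open FirstOrder FirstOrder.Language

/-- `κ` witnesses the downward Löwenheim-Skolem axiom for the class `mem` of `L`-structures with
strong submodel relation `strong`. -/
def IsLSCardinal {L : FirstOrder.Language.{u, u}} (mem : ∀ (M : Type u) [L.Structure M], Prop)
    (strong : ∀ {M : Type u} [L.Structure M], L.Substructure M → Prop) (κ : Cardinal.{u}) : Prop :=
  ℵ₀ ≤ κ ∧ ∀ (M : Type u) [L.Structure M], mem M → ∀ A : Set M,
    ∃ S : L.Substructure M, A ⊆ (S : Set M) ∧ strong S ∧ #S ≤ #A + κ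

/-- Abstract elementary classes in a one-sorted finitary signature `L`. The class is `mem`, and
`strong S`, for a substructure `S` of `N`, says `S ≺ N`. That strong submodels are substructures,
and the antisymmetry of `≺`, are built into this representation. -/
structure AEC (L : FirstOrder.Language.{u, u}) where
  /-- membership of an `L`-structure in the class -/
  mem : ∀ (M : Type u) [L.Structure M], Prop
  /-- being a strong submodel of the ambient structure -/
  strong : ∀ {M : Type u} [L.Structure M], L.Substructure M → Prop
  /-- `≺` is a relation between members of the class -/
  mem_of_strong : ∀ {M : Type u} [L.Structure M] (S : L.Substructure M),
    strong S → mem M ∧ mem S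
  /-- the class is closed under isomorphism -/
  mem_iso : ∀ {M N : Type u} [L.Structure M] [L.Structure N], (M ≃[L] N) → mem M → mem N
  /-- `≺` is closed under isomorphism -/
  strong_iso : ∀ {M N : Type u} [L.Structure M] [L.Structure N] (e : M ≃[L] N)
    (S : L.Substructure M), strong S → strong (S.map e.toHom)
  /-- `≺` is reflexive -/
  strong_refl : ∀ (M : Type u) [L.Structure M], mem M → strong (⊤ : L.Substructure M)
  /-- `≺` is transitive -/
  strong_trans : ∀ {M : Type u} [L.Structure M] (S T : L.Substructure M), S ≤ T →
    strong (S.within T) → strong T → strong S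
  /-- Unions of chains. The members of a chain `(M_α)_{α < δ}`, `δ` a limit ordinal, are
  substructures of some `L`-structure `X` (for instance of the union of the chain), which need not
  be in the class for the first two assertions. -/
  strong_chain : ∀ (X : Type u) [L.Structure X] (δ : Ordinal.{u}) (S : Ordinal.{u} → L.Substructure X),
    Order.IsSuccLimit δ →
    (∀ α β, α ≤ β → β < δ → S α ≤ S β ∧ strong ((S α).within (S β))) →
    (∀ β, β < δ → Order.IsSuccLimit β → S β = ⨆ α : Set.Iio β, S α) →
    mem ↥(⨆ α : Set.Iio δ, S α) ∧
    (∀ α, α < δ → strong ((S α).within (⨆ α : Set.Iio δ, S α))) ∧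
    ((∀ α, α < δ → strong (S α)) → strong (⨆ α : Set.Iio δ, S α))
  /-- coherence -/
  coherence : ∀ {M : Type u} [L.Structure M] (S T : L.Substructure M),
    strong S → strong T → S ≤ T → strong (S.within T)
  /-- downward Löwenheim-Skolem -/
  exists_LS : ∃ κ : Cardinal.{u}, IsLSCardinal mem strong κ

namespace AEC

variable {L : FirstOrder.Language.{u, u}} (K : AEC L)

/-- The Löwenheim-Skolem number: the least cardinal as in the downward Löwenheim-Skolem axiom. -/
noncomputable def LS : Cardinal.{u} := sInf {κ | IsLSCardinal K.mem K.strong κ}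

/-- The structures in the class. -/
structure Model where
  /-- the underlying set -/
  carrier : Type u
  /-- the `L`-structure -/
  [str : L.Structure carrier]
  /-- it is in the class -/
  isMem : K.mem carrier

attribute [instance] Model.str

instance : CoeSort K.Model (Type u) := ⟨Model.carrier⟩

variable {K}

/-- Strong embeddings: embeddings of `L`-structures whose image is a strong submodel. -/
structure StrongEmb (M N : K.Model) where
  /-- the underlying embedding -/
  toEmb : M ↪[L] N
  /-- the image is a strong submodel -/
  strong_range : K.strong toEmb.toHom.range

instance (M N : K.Model) : CoeFun (StrongEmb M N) (fun _ => M → N) := ⟨fun f => f.toEmb⟩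

/-- Composition `g ∘ f` of strong embeddings. -/
def StrongEmb.comp {M N P : K.Model} (g : StrongEmb N P) (f : StrongEmb M N) : StrongEmb M P where
  toEmb := g.toEmb.comp f.toEmb
  strong_range := by
    refine K.strong_trans _ g.toEmb.toHom.range ?_ ?_ g.strong_range
    · rintro _ ⟨x, rfl⟩
      exact ⟨f.toEmb x, rfl⟩
    · have h := K.strong_iso g.toEmb.equivRange _ f.strong_range
      convert h using 1
      ext ⟨y, hy⟩
      constructor
      · rintro ⟨x, hx⟩
        exact ⟨f.toEmb x, ⟨x, rfl⟩, Subtype.ext hx⟩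
      · rintro ⟨_, ⟨x, rfl⟩, hx⟩
        exact ⟨x, congrArg Subtype.val hx⟩

variable (K)

/-- Joint embedding property. -/
def JEP : Prop :=
  ∀ M₁ M₂ : K.Model, ∃ M : K.Model, Nonempty (StrongEmb M₁ M) ∧ Nonempty (StrongEmb M₂ M)

/-- Amalgamation property. -/
def AP : Prop :=
  ∀ (M₀ M₁ M₂ : K.Model) (f₁ : StrongEmb M₀ M₁) (f₂ : StrongEmb M₀ M₂),
    ∃ (N : K.Model) (g₁ : StrongEmb M₁ N) (g₂ : StrongEmb M₂ N), ∀ x, g₁ (f₁ x) = g₂ (f₂ x)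

variable {K}

/-- The strong submodels of `M` of cardinality at most `κ`. -/
def Sub (κ : Cardinal.{u}) (M : K.Model) : Type u :=
  {S : L.Substructure M // K.strong S ∧ #S ≤ κ}

/-- A strong submodel as a member of the class. -/
def Sub.model {κ : Cardinal.{u}} {M : K.Model} (N : Sub κ M) : K.Model :=
  ⟨N.1, (K.mem_of_strong N.1 N.2.1).2⟩

/-- The inclusion of a strong submodel. -/
def Sub.incl {κ : Cardinal.{u}} {M : K.Model} (N : Sub κ M) : StrongEmb N.model M where
  toEmb := N.1.subtype
  strong_range := by
    have h : N.1.subtype.toHom.range = N.1 := Substructure.range_subtype N.1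
    exact h.symm ▸ N.2.1

/-- A point in a strong extension of `M`. -/
structure Point (M : K.Model) where
  /-- the extension -/
  ext : K.Model
  /-- its strong embedding over `M` -/
  emb : StrongEmb M ext
  /-- the point -/
  pt : ext

/-- Two points have the same Galois type over `M` if strong embeddings over `M` of their ambient
models into some member of the class identify them. -/
def SameType (M : K.Model) (x y : Point M) : Prop :=
  ∃ (P : K.Model) (g : StrongEmb x.ext P) (h : StrongEmb y.ext P),
    (∀ m, g (x.emb m) = h (y.emb m)) ∧ g x.pt = h y.pt

/-- The set of Galois types over `M`, i.e. of points modulo the equivalence relation generated by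
`SameType M` (which is itself an equivalence relation if `K` has amalgamation). -/
def GaS (M : K.Model) : Type (u + 1) := Quot (SameType M)

/-- The restriction of a Galois type along a strong embedding `f : M → N`; for an inclusion of a
strong submodel this is the restriction to that submodel. -/
def restrict {M N : K.Model} (f : StrongEmb M N) : GaS N → GaS M :=
  Quot.map (fun x => ⟨x.ext, x.emb.comp f, x.pt⟩)
    (fun _ _ ⟨P, g, h, hm, hp⟩ => ⟨P, g, h, fun m => hm (f m), hp⟩)

variable (K)

/-- `κ`-Galois-stability. -/
def Stable (κ : Cardinal.{u}) : Prop :=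
  ∀ M : K.Model, #M = κ → #(GaS M) = Cardinal.lift.{u + 1} κ

/-- `κ`-tameness. -/
def Tame (κ : Cardinal.{u}) : Prop :=
  ∀ (M : K.Model) (p p' : GaS M), p ≠ p' → ∃ N : Sub κ M, restrict N.incl p ≠ restrict N.incl p'

variable {K}

/-- The relation `RM^κ[q] ≥ α`, by recursion on `α`; this is meant for types `q` over models of
cardinality at most `κ`. -/
def RankGE (κ : Cardinal.{u}) (α : Ordinal.{u}) : ∀ M : K.Model, GaS M → Prop :=
  Ordinal.limitRecOn (motive := fun _ => ∀ M : K.Model, GaS M → Prop) α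
    (fun _ _ => True)
    (fun _ ge M q => ∃ (M' : K.Model) (f : StrongEmb M M'),
      Cardinal.lift.{u + 1} κ <
        #{q' : GaS M' // restrict f q' = q ∧
          ∀ N : Sub κ M', ge N.model (restrict N.incl q')})
    (fun γ _ ge M q => ∀ (β : Ordinal.{u}) (h : β < γ), ge β h M q)

/-- The rank of a type over a model of cardinality at most `κ`: the largest `α` with
`RM^κ[q] ≥ α`, and `⊤` (that is, `∞`) if this holds for all ordinals. -/
noncomputable def smallRM (κ : Cardinal.{u}) (M : K.Model) (q : GaS M) : WithTop Ordinal.{u} :=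
  sSup {x | ∃ α : Ordinal.{u}, RankGE κ α M q ∧ x = α}

/-- The rank `RM^κ[q]` of a Galois type over an arbitrary model `M`: the minimum of the ranks of its
restrictions to strong submodels of cardinality at most `κ`. -/
noncomputable def RM (κ : Cardinal.{u}) (M : K.Model) (q : GaS M) : WithTop Ordinal.{u} :=
  ⨅ N : Sub κ M, smallRM κ N.model (restrict N.incl q)

variable (K)

/-- `κ`-total transcendence. -/
def TotallyTranscendental (κ : Cardinal.{u}) : Prop :=
  ∀ (M : K.Model) (q : GaS M), ∃ α : Ordinal.{u}, RM κ M q = α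

end AEC

/-! # Totally transcendental abstract elementary classes from stability and tameness -/

open CategoryTheory Limits

namespace AEC

/-! ### Strong embeddings and unions of chains inside an ambient structure -/

variable {L : FirstOrder.Language.{u, u}} (K : AEC L)

/-! Write λ for the stability cardinal. If total transcendence fails, some type over a model of size
at most λ has rank `∞`. Up to isomorphism there is only a set of types over such models, so there is
one ordinal α₀ such that rank at least α₀ already means rank `∞` (`exists_rank_bound`). Applying the
definition of rank at least α₀ + 1 to an unranked type gives more than λ extensions whose small
restrictions are all unranked. Tameness separates λ of them over λ² = λ submodels of size at most χ,
so they stay distinct over a single model of size at most λ (`Unranked.exists_splitting`).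

Iterating this yields a λ-branching tree of height ω of unranked types. The tree of models
amalgamates, each branch has a limit type by `exists_type_nat_chain`, and different branches differ
over the model where they split. Since λ^{<ω} = λ, all nodes fit into one model of size at most λ,
which carries λ^{ℵ₀} > λ types (`exists_many_types`). Enlarging it to size exactly λ loses no types
and contradicts stability.

Amalgamating λ models at once needs a transfinite iteration of binary amalgamation, hence the
treatment of unions of chains as colimits. -/

/-- An embedding of structures is strong if its image is a strong submodel. -/
def IsStrong {M N : Type u} [L.Structure M] [L.Structure N] (f : M ↪[L] N) : Prop :=
  K.strong f.toHom.range

variable {K}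

theorem IsStrong.comp {M N P : Type u} [L.Structure M] [L.Structure N] [L.Structure P]
    {g : N ↪[L] P} {f : M ↪[L] N} (hg : K.IsStrong g) (hf : K.IsStrong f) :
    K.IsStrong (g.comp f) :=
  (StrongEmb.comp (M := ⟨M, K.mem_iso f.equivRange.symm (K.mem_of_strong _ hf).2⟩)
    (N := ⟨N, (K.mem_of_strong _ hf).1⟩) (P := ⟨P, (K.mem_of_strong _ hg).1⟩)
    ⟨g, hg⟩ ⟨f, hf⟩).strong_range

theorem isStrong_equiv {M N : Type u} [L.Structure M] [L.Structure N] (e : M ≃[L] N)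
    (h : K.mem N) : K.IsStrong e.toEmbedding := by
  have : e.toEmbedding.toHom.range = ⊤ := by
    ext y
    exact ⟨fun _ => trivial, fun _ => ⟨e.symm y, e.apply_symm_apply y⟩⟩
  unfold IsStrong
  rw [this]
  exact K.strong_refl N h

/-- This is the coherence axiom, pulled back along the isomorphism of `N` with its image under `g`.
-/
theorem IsStrong.of_comp {M N P : Type u} [L.Structure M] [L.Structure N] [L.Structure P]
    {g : N ↪[L] P} {f : M ↪[L] N} (hg : K.IsStrong g) (hgf : K.IsStrong (g.comp f)) :
    K.IsStrong f := by
  have hle : (g.comp f).toHom.range ≤ g.toHom.range := by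
    rintro _ ⟨x, rfl⟩
    exact ⟨f x, rfl⟩
  have h := K.strong_iso g.equivRange.symm _ (K.coherence _ _ hgf hg hle)
  unfold IsStrong
  convert h using 1
  ext y
  constructor
  · rintro ⟨x, rfl⟩
    refine ⟨⟨g (f x), ⟨f x, rfl⟩⟩, ⟨x, rfl⟩, ?_⟩
    apply g.equivRange.injective
    exact (g.equivRange.apply_symm_apply _).trans (Subtype.ext rfl)
  · rintro ⟨⟨_, ⟨z, rfl⟩⟩, ⟨x, hx⟩, rfl⟩
    obtain rfl : f x = z := g.injective hx
    exact ⟨x, (g.equivRange.symm_apply_apply _).symm⟩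

theorem range_inclusion {X : Type u} [L.Structure X] {A B : L.Substructure X} (h : A ≤ B) :
    (Substructure.inclusion h).toHom.range = A.within B := by
  ext y
  constructor
  · rintro ⟨x, rfl⟩
    exact x.2
  · intro hy
    exact ⟨⟨y.1, hy⟩, Subtype.ext rfl⟩

variable (K) in
/-- `A` is a strong submodel of `B`, for substructures `A`, `B` of an ambient structure. -/
def StrongIn {X : Type u} [L.Structure X] (A B : L.Substructure X) : Prop :=
  A ≤ B ∧ K.strong (A.within B)

theorem strongIn_iff {X : Type u} [L.Structure X] {A B : L.Substructure X} (h : A ≤ B) :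
    K.StrongIn A B ↔ K.IsStrong (Substructure.inclusion h) := by
  unfold StrongIn IsStrong
  rw [range_inclusion]
  exact and_iff_right h

theorem StrongIn.trans {X : Type u} [L.Structure X] {A B C : L.Substructure X}
    (h₁ : K.StrongIn A B) (h₂ : K.StrongIn B C) : K.StrongIn A C := by
  rw [strongIn_iff (h₁.1.trans h₂.1)]
  exact ((strongIn_iff h₂.1).1 h₂).comp ((strongIn_iff h₁.1).1 h₁)

/-- Images commute with suprema, and the inclusion of `B` is injective, so both sides are compared
through their images in `X`. -/
theorem iSup_within {X : Type u} [L.Structure X] {ι : Type*} (S : ι → L.Substructure X)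
    (B : L.Substructure X) (h : ∀ i, S i ≤ B) :
    (⨆ i, S i).within B = ⨆ i, (S i).within B := by
  have key : ∀ A : L.Substructure X, A ≤ B → (A.within B).map B.subtype.toHom = A := by
    intro A hA
    ext x
    constructor
    · rintro ⟨y, hy, rfl⟩
      exact hy
    · intro hx
      exact ⟨⟨x, hA hx⟩, hx, rfl⟩
  apply Substructure.map_injective_of_injective (f := B.subtype.toHom) B.subtype.injective
  refine (key _ (iSup_le h)).trans ?_
  refine Eq.trans ?_ (Substructure.map_iSup _ _).symm
  exact iSup_congr fun i => (key _ (h i)).symm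

open Classical in
/-- Unions of chains that need not be continuous. -/
theorem strong_iSup_ordinal (δ : Ordinal.{u}) : ∀ (X : Type u) [L.Structure X]
    (S : Ordinal.{u} → L.Substructure X), Order.IsSuccLimit δ →
    (∀ α β, α ≤ β → β < δ → K.StrongIn (S α) (S β)) →
    K.mem ↥(⨆ α : Set.Iio δ, S α) ∧
    (∀ α, α < δ → K.StrongIn (S α) (⨆ α : Set.Iio δ, S α)) ∧
    ((∀ α, α < δ → K.strong (S α)) → K.strong (⨆ α : Set.Iio δ, S α)) := by
  induction δ using WellFoundedLT.induction with
  | ind δ ih =>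
  intro X _ S hδ hS
  -- The axiom requires continuity at limits, so `S` is replaced by its unions at limit indices. The
  -- total union is unchanged.
  let T : Ordinal.{u} → L.Substructure X := fun α =>
    if Order.IsSuccLimit α then ⨆ γ : Set.Iio α, S γ else S α
  have hT1 : ∀ α, Order.IsSuccLimit α → T α = ⨆ γ : Set.Iio α, S γ := fun α h => if_pos h
  have hT2 : ∀ α, ¬ Order.IsSuccLimit α → T α = S α := fun α h => if_neg h
  have hTS : ∀ α, α < δ → T α ≤ S α := by
    intro α hα
    by_cases h : Order.IsSuccLimit α
    · rw [hT1 α h]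
      exact iSup_le fun γ => (hS γ α (le_of_lt γ.2) hα).1
    · rw [hT2 α h]
  have hTS' : ∀ α, α < δ → Order.IsSuccLimit α → ∀ β, α ≤ β → β < δ →
      K.StrongIn (T α) (S β) := by
    intro α hα hl β hαβ hβ
    rw [hT1 α hl]
    have hle : ∀ γ : Set.Iio α, S γ ≤ S β := fun γ => (hS γ β ((le_of_lt γ.2).trans hαβ) hβ).1
    refine ⟨iSup_le hle, ?_⟩
    rw [iSup_within _ _ hle]
    -- The induction hypothesis is used with `S β` as the ambient structure, which is why it
    -- quantifies over `X`.
    refine (ih α hα (S β) (fun γ => (S γ).within (S β)) hl ?_).2.2 ?_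
    · intro γ γ' hγ hγ'
      have h1 := hS γ β (hγ.trans (hγ'.le.trans hαβ)) hβ
      have h2 := hS γ' β (hγ'.le.trans hαβ) hβ
      have h3 := hS γ γ' hγ (hγ'.trans hα)
      have h4 : (S γ).within (S β) ≤ (S γ').within (S β) := fun x hx => h3.1 hx
      exact ⟨h4, K.coherence _ _ h1.2 h2.2 h4⟩
    · intro γ hγ
      exact (hS γ β (hγ.le.trans hαβ) hβ).2
  have hST : ∀ α β, α < β → β < δ → K.StrongIn (S α) (T β) := by
    intro α β hαβ hβ
    by_cases h : Order.IsSuccLimit β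
    · rw [hT1 β h]
      exact (ih β hβ X S h fun a b hab hb => hS a b hab (hb.trans hβ)).2.1 α hαβ
    · rw [hT2 β h]
      exact hS α β hαβ.le hβ
  have hTT : ∀ α β, α ≤ β → β < δ → K.StrongIn (T α) (T β) := by
    intro α β hαβ hβ
    rcases hαβ.eq_or_lt with rfl | hlt
    · by_cases h : Order.IsSuccLimit α
      · refine ⟨le_rfl, ?_⟩
        have hm : K.mem (T α) := by
          rw [hT1 α h]
          exact (ih α hβ X S h fun a b hab hb => hS a b hab (hb.trans hβ)).1
        convert K.strong_refl _ hm
        ext x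
        exact ⟨fun _ => trivial, fun _ => x.2⟩
      · rw [hT2 α h]
        exact hS α α le_rfl hβ
    · by_cases h : Order.IsSuccLimit α
      · by_cases h' : Order.IsSuccLimit β
        -- Between two limit indices the relation passes through the original chain at the successor
        -- of `α`.
        · have := h'.succ_lt hlt
          exact (hTS' α (hlt.trans hβ) h _ (Order.le_succ α) (this.trans hβ)).trans
            (hST _ _ this hβ)
        · rw [hT2 β h']
          exact hTS' α (hlt.trans hβ) h β hαβ hβ
      · rw [hT2 α h]
        exact hST α β hlt hβ
  have hsup : ∀ β, β ≤ δ → Order.IsSuccLimit β →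
      (⨆ α : Set.Iio β, T α) = ⨆ α : Set.Iio β, S α := by
    intro β hβ hl
    apply le_antisymm
    · exact iSup_mono fun α => hTS _ (lt_of_lt_of_le α.2 hβ)
    · refine iSup_le fun α => ?_
      have h1 : Order.succ α.1 < β := hl.succ_lt α.2
      exact (hST α _ (Order.lt_succ α.1) (h1.trans_le hβ)).1.trans
        (le_iSup (fun a : Set.Iio β => T a) ⟨_, h1⟩)
  have main := K.strong_chain X δ T hδ hTT (fun β hβ hl => by
    rw [hsup β hβ.le hl, hT1 β hl])
  rw [hsup δ le_rfl hδ] at main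
  refine ⟨main.1, fun α hα => ?_, fun hs => main.2.2 fun α hα => ?_⟩
  · have h1 := hδ.succ_lt hα
    exact (hST α _ (Order.lt_succ α) h1).trans
      ⟨hsup δ le_rfl hδ ▸ le_iSup (fun a : Set.Iio δ => T a) ⟨_, h1⟩, main.2.1 _ h1⟩
  · by_cases h : Order.IsSuccLimit α
    · rw [hT1 α h]
      exact (ih α hα X S h fun a b hab hb => hS a b hab (hb.trans hα)).2.2
        fun γ hγ => hs γ (hγ.trans hα)
    · rw [hT2 α h]
      exact hs α hα

/-- Unions of chains indexed by a well-ordered type without maximum. -/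
theorem strong_iSup {J : Type u} [LinearOrder J] [WellFoundedLT J] [Nonempty J] [NoMaxOrder J]
    {X : Type u} [L.Structure X] (S : J → L.Substructure X)
    (hS : ∀ i j, i ≤ j → K.StrongIn (S i) (S j)) :
    K.mem ↥(⨆ j, S j) ∧ (∀ j, K.StrongIn (S j) (⨆ j, S j)) ∧
      ((∀ j, K.strong (S j)) → K.strong (⨆ j, S j)) := by
  classical
  let δ : Ordinal.{u} := Ordinal.type (α := J) (· < ·)
  let e : Set.Iio δ ≃o J := OrderIso.ofRelIsoLT (Ordinal.enum (α := J) (· < ·))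
  have hδ : Order.IsSuccLimit δ := by
    rw [Ordinal.isSuccLimit_iff]
    exact ⟨Ordinal.type_ne_zero_iff_nonempty.2 inferInstance, Ordinal.isSuccPrelimit_type_lt⟩
  let T : Ordinal.{u} → L.Substructure X := fun α => if h : α < δ then S (e ⟨α, h⟩) else ⊥
  have hT : ∀ α : Set.Iio δ, T α = S (e α) := fun α => dif_pos α.2
  have hsup : (⨆ α : Set.Iio δ, T α) = ⨆ j, S j := by
    simp_rw [hT]
    exact e.toEquiv.iSup_comp (g := S)
  have main := strong_iSup_ordinal δ X T hδ (fun α β hαβ hβ => by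
    rw [hT ⟨α, hαβ.trans_lt hβ⟩, hT ⟨β, hβ⟩]
    exact hS _ _ (e.monotone hαβ))
  rw [hsup] at main
  refine ⟨main.1, fun j => ?_, fun hs => main.2.2 fun α hα => ?_⟩
  · have := main.2.1 (e.symm j) (e.symm j).2
    rwa [hT, e.apply_symm_apply] at this
  · rw [hT ⟨α, hα⟩]
    exact hs _


/-! ### Models as a category, with unions of chains as colimits -/

theorem StrongEmb.ext {M N : K.Model} {f g : StrongEmb M N} (h : ∀ x, f x = g x) : f = g := by
  cases f
  cases g
  congr
  exact DFunLike.ext _ _ h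

/-- The identity as a strong embedding. -/
def StrongEmb.id (M : K.Model) : StrongEmb M M where
  toEmb := Embedding.refl L M
  strong_range := isStrong_equiv (FirstOrder.Language.Equiv.refl L M) M.isMem

instance : Category K.Model where
  Hom := StrongEmb
  id := StrongEmb.id
  comp f g := StrongEmb.comp g f

section Colimit

variable {J : Type u} [LinearOrder J] [WellFoundedLT J] [Nonempty J] [NoMaxOrder J]
  (F : J ⥤ K.Model)

/-- The transition maps of a chain of models. -/
def transition (i j : J) (h : i ≤ j) : F.obj i ↪[L] F.obj j :=
  StrongEmb.toEmb (F.map (homOfLE h))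

instance : DirectedSystem (fun i => F.obj i) fun i j h => transition F i j h where
  map_self i x := by
    have : F.map (homOfLE (le_refl i)) = 𝟙 _ := F.map_id i
    unfold transition
    rw [this]
    rfl
  map_map i j k hij hjk x := by
    have : F.map (homOfLE (hij.trans hjk)) = F.map (homOfLE hij) ≫ F.map (homOfLE hjk) :=
      F.map_comp _ _
    unfold transition
    rw [this]
    rfl

/-- Up to the isomorphisms of `A` and `B` with their images, the inclusion of images is `f`. The
ambient `X` need not be in the class, so this applies to direct limits before membership is known.
-/
theorem strongIn_range {X : Type u} [L.Structure X] {A B : K.Model} (f : StrongEmb A B)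
    (g : B ↪[L] X) (h : A ↪[L] X) (e : ∀ x, h x = g (f x)) :
    K.StrongIn h.toHom.range g.toHom.range := by
  have hle : h.toHom.range ≤ g.toHom.range := by
    rintro _ ⟨x, rfl⟩
    exact ⟨f x, (e x).symm⟩
  rw [strongIn_iff hle]
  have hB := K.mem_iso g.equivRange B.isMem
  have h1 : K.IsStrong ((g.equivRange.toEmbedding.comp f.toEmb).comp
      h.equivRange.symm.toEmbedding) :=
    ((isStrong_equiv g.equivRange hB).comp f.strong_range).comp
      (isStrong_equiv h.equivRange.symm A.isMem)
  convert h1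
  ext ⟨_, ⟨x, rfl⟩⟩
  have h2 : h.equivRange.symm ⟨h x, ⟨x, rfl⟩⟩ = x := h.equivRange.symm_apply_apply x
  refine (e x).trans ?_
  change g (f x) = g (f (h.equivRange.symm ⟨h x, ⟨x, rfl⟩⟩))
  rw [h2]

theorem colimit_mem : K.mem (Language.DirectLimit (fun i => F.obj i) (transition F)) ∧
    ∀ j, K.IsStrong (Language.DirectLimit.of L J (fun i => F.obj i) (transition F) j) := by
  have h := strong_iSup (K := K)
    (fun j => (Language.DirectLimit.of L J (fun i => F.obj i) (transition F) j).toHom.range)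
    (fun i j hij => strongIn_range (F.map (homOfLE hij)) _ _ fun x =>
      (Language.DirectLimit.of_f (f := transition F) (hij := hij)).symm)
  rw [Language.DirectLimit.iSup_range_of_eq_top] at h
  have hm : K.mem (Language.DirectLimit (fun i => F.obj i) (transition F)) :=
    K.mem_iso Substructure.topEquiv h.1
  refine ⟨hm, fun j => ?_⟩
  exact K.strong_trans _ ⊤ (h.2.1 j).1 (h.2.1 j).2 (K.strong_refl _ hm)

/-- The union of a chain of models, as a cocone. -/
noncomputable def chainCocone : Cocone F where
  pt := ⟨Language.DirectLimit (fun i => F.obj i) (transition F), (colimit_mem F).1⟩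
  ι :=
    { app := fun j => StrongEmb.mk (Language.DirectLimit.of L J (fun i => F.obj i) (transition F) j)
        ((colimit_mem F).2 j)
      naturality := fun _ _ f => StrongEmb.ext fun _ =>
        Language.DirectLimit.of_f (f := transition F) (hij := leOfHom f) }

omit [WellFoundedLT J] [Nonempty J] [NoMaxOrder J] in
theorem cocone_apply (s : Cocone F) (i j : J) (hij : i ≤ j) (x : F.obj i) :
    StrongEmb.toEmb (s.ι.app j) (transition F i j hij x) = StrongEmb.toEmb (s.ι.app i) x :=
  congrArg (fun f : StrongEmb (F.obj i) s.pt => f x) (s.w (homOfLE hij))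

/-- The embedding of the union of a chain induced by a cocone. -/
noncomputable def chainDesc (s : Cocone F) :
    Language.DirectLimit (fun i => F.obj i) (transition F) ↪[L] s.pt :=
  Language.DirectLimit.lift L J (fun i => F.obj i) (transition F)
    (fun i => StrongEmb.toEmb (s.ι.app i)) (cocone_apply F s)

omit [WellFoundedLT J] [NoMaxOrder J] in
theorem chainDesc_of (s : Cocone F) (i : J) (x : F.obj i) :
    chainDesc F s (Language.DirectLimit.of L J (fun i => F.obj i) (transition F) i x) =
      StrongEmb.toEmb (s.ι.app i) x :=
  Language.DirectLimit.lift_of (ι := J) (G := fun i => F.obj i)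
    (fun i => StrongEmb.toEmb (s.ι.app i)) (cocone_apply F s) x

/-- The image is the union of the images of the stages, each strong in `s.pt`, so the last clause of
the chain axiom applies. -/
theorem isStrong_chainDesc (s : Cocone F) : K.IsStrong (chainDesc F s) := by
  unfold IsStrong chainDesc
  rw [Language.DirectLimit.range_lift]
  exact (strong_iSup (K := K) _ fun i j hij => strongIn_range (F.map (homOfLE hij)) _ _
    fun x => (cocone_apply F s i j hij x).symm).2.2 fun j => (s.ι.app j).strong_range

/-- The union of a chain of models is its colimit. -/
noncomputable def chainIsColimit : IsColimit (chainCocone F) where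
  desc s := StrongEmb.mk (chainDesc F s) (isStrong_chainDesc F s)
  fac s j := StrongEmb.ext fun x => chainDesc_of F s j x
  uniq s m hm := StrongEmb.ext fun x => by
    obtain ⟨i, y, rfl⟩ := Language.DirectLimit.exists_of (L := L) x
    exact (congrArg (fun f : StrongEmb (F.obj i) s.pt => f y) (hm i)).trans
      (chainDesc_of F s i y).symm

instance hasColimitsOfShape_chain : HasColimitsOfShape J K.Model where
  has_colimit F := ⟨⟨⟨chainCocone F, chainIsColimit F⟩⟩⟩

end Colimit

instance hasColimitsOfShape_nat : HasColimitsOfShape ℕ K.Model := by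
  have : NoMaxOrder (ULift.{u} ℕ) := ⟨fun a => ⟨⟨a.down + 1⟩, Nat.lt_succ_self a.down⟩⟩
  have : WellFoundedLT (ULift.{u} ℕ) :=
    ⟨InvImage.wf ULift.down (wellFounded_lt (α := ℕ))⟩
  let e : ULift.{u} ℕ ≃o ℕ := { Equiv.ulift with map_rel_iff' := Iff.rfl }
  exact hasColimitsOfShape_of_equivalence e.equivalence


/-! ### Amalgamation of families by transfinite iteration -/

instance hasIterationOfShape_chain {J : Type u} [LinearOrder J] [WellFoundedLT J] [Nonempty J]
    [NoMaxOrder J] (M : K.Model) : HasIterationOfShape J (Under M) where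
  hasColimitsOfShape_of_isSuccLimit j hj := by
    have : NoMaxOrder (Set.Iio j) := ⟨fun a => by
      let := SuccOrder.ofLinearWellFoundedLT J
      exact ⟨⟨Order.succ a.1, hj.succ_lt a.2⟩, Order.lt_succ a.1⟩⟩
    have : Nonempty (Set.Iio j) := by
      obtain ⟨a, ha⟩ := not_isMin_iff.1 hj.not_isMin
      exact ⟨⟨a, ha⟩⟩
    infer_instance

/-- The successor step of the iteration. Working under `M` keeps the base fixed. Once every `N i`
embeds in `X`, the step does nothing. -/
theorem exists_absorbing_step (hAP : K.AP) {M : K.Model} {ι : Type u} (N : ι → Under M)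
    (X : Under M) : ∃ (Y : Under M) (_ : X ⟶ Y), (∃ i, IsEmpty (N i ⟶ X)) →
      ∃ i, IsEmpty (N i ⟶ X) ∧ Nonempty (N i ⟶ Y) := by
  by_cases h : ∃ i, IsEmpty (N i ⟶ X)
  · obtain ⟨i, hi⟩ := h
    obtain ⟨P, g₁, g₂, hg⟩ := hAP M X.right (N i).right X.hom (N i).hom
    have hg' : X.hom ≫ (show X.right ⟶ P from g₁) = (N i).hom ≫ (show (N i).right ⟶ P from g₂) :=
      StrongEmb.ext hg
    exact ⟨Under.mk (X.hom ≫ (show X.right ⟶ P from g₁)), Under.homMk g₁ rfl,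
      fun _ => ⟨i, hi, ⟨Under.homMk g₂ hg'.symm⟩⟩⟩
  · exact ⟨X, 𝟙 X, fun h' => (h h').elim⟩

/-- Amalgamation of a family of extensions of a model. -/
theorem exists_amalgam_family (hAP : K.AP) {M : K.Model} {ι : Type u} (N : ι → K.Model)
    (f : ∀ i, StrongEmb M (N i)) : ∃ (P : K.Model) (h : StrongEmb M P)
      (g : ∀ i, StrongEmb (N i) P), ∀ i x, g i (f i x) = h x := by
  let N' : ι → Under M := fun i => Under.mk (show M ⟶ N i from f i)
  choose Y y hy using exists_absorbing_step hAP N'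
  let Φ : SmallObject.SuccStruct (Under M) := ⟨Under.mk (𝟙 M), Y, y⟩
  -- More steps than there are models to absorb.
  let c : Cardinal.{u} := Order.succ (max #ι ℵ₀)
  let J := c.ord.ToType
  have hc : ℵ₀ ≤ c := (le_max_right _ _).trans (Order.le_succ _)
  have : NoMaxOrder J := Cardinal.noMaxOrder hc
  have hJ : #J = c := mk_ord_toType c
  have : Nonempty J := by
    rw [← mk_ne_zero_iff, hJ]
    exact (aleph0_pos.trans_le hc).ne'
  let : OrderBot J := WellFoundedLT.toOrderBot J
  let F := Φ.iterationFunctor J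
  by_cases h : ∃ j, ∀ i, Nonempty (N' i ⟶ F.obj j)
  · obtain ⟨j, hj⟩ := h
    refine ⟨(F.obj j).right, (F.obj j).hom, fun i => (hj i).some.right, fun i x => ?_⟩
    exact congrArg (fun k : StrongEmb M (F.obj j).right => k x) (Under.w (hj i).some)
  · push Not at h
    choose i hi hi' using fun j => hy (F.obj j) (h j)
    have hs : ∀ j, Nonempty (N' (i j) ⟶ F.obj (Order.succ j)) := fun j =>
      ⟨(hi' j).some ≫ (Φ.iterationFunctorObjSuccIso j (not_isMax j)).inv⟩
    -- A model absorbed at step `j` embeds in all later stages, so it is never selected again.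
    have hlt : ∀ j j', j < j' → i j ≠ i j' := fun j j' hjj' he =>
      (hi j').false (he ▸ (hs j).some ≫ F.map (homOfLE (Order.succ_le_of_lt hjj')))
    have hinj : Function.Injective i := fun j j' he => by
      by_contra hne
      rcases lt_or_gt_of_ne hne with hl | hl
      · exact hlt _ _ hl he
      · exact hlt _ _ hl he.symm
    have := mk_le_of_injective hinj
    rw [hJ] at this
    exact absurd ((Order.lt_succ _).trans_le this) (le_max_left _ _).not_gt


/-! ### Galois types, their restrictions and limits -/

/-- The Galois type of a point. -/
def galoisType {M : K.Model} (x : Point M) : GaS M := Quot.mk _ x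

theorem exists_galoisType {M : K.Model} (q : GaS M) : ∃ x, galoisType x = q := Quot.exists_rep q

theorem restrict_galoisType {M N : K.Model} (f : StrongEmb M N) (x : Point N) :
    restrict f (galoisType x) = galoisType ⟨x.ext, x.emb.comp f, x.pt⟩ := rfl

theorem restrict_comp {M N P : K.Model} (f : StrongEmb M N) (g : StrongEmb N P) (q : GaS P) :
    restrict f (restrict g q) = restrict (g.comp f) q := by
  obtain ⟨x, rfl⟩ := exists_galoisType q
  rfl

theorem restrict_id {M : K.Model} (q : GaS M) : restrict (StrongEmb.id M) q = q := by
  obtain ⟨x, rfl⟩ := exists_galoisType q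
  rfl

theorem SameType.refl {M : K.Model} (x : Point M) : SameType M x x :=
  ⟨x.ext, StrongEmb.id _, StrongEmb.id _, fun _ => rfl, rfl⟩

theorem SameType.symm {M : K.Model} {x y : Point M} : SameType M x y → SameType M y x :=
  fun ⟨P, g, h, hm, hp⟩ => ⟨P, h, g, fun m => (hm m).symm, hp.symm⟩

theorem SameType.trans (hAP : K.AP) {M : K.Model} {x y z : Point M} :
    SameType M x y → SameType M y z → SameType M x z := by
  rintro ⟨P, g, h, hm, hp⟩ ⟨P', g', h', hm', hp'⟩
  obtain ⟨Q, k, k', hk⟩ := hAP y.ext P P' h g'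
  refine ⟨Q, k.comp g, k'.comp h', fun m => ?_, ?_⟩
  · change k (g (x.emb m)) = k' (h' (z.emb m))
    rw [hm, hk, hm']
  · change k (g x.pt) = k' (h' z.pt)
    rw [hp, hk, hp']

theorem galoisType_eq_iff (hAP : K.AP) {M : K.Model} {x y : Point M} :
    galoisType x = galoisType y ↔ SameType M x y := by
  refine ⟨fun h => ?_, Quot.sound⟩
  have he : Equivalence (SameType M) := ⟨SameType.refl, SameType.symm, SameType.trans hAP⟩
  exact he.eqvGen_iff.1 (Quot.eqvGen_exact h)

theorem galoisType_eq_of_emb {M : K.Model} {x y : Point M} (g : StrongEmb x.ext y.ext)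
    (hm : ∀ m, g (x.emb m) = y.emb m) (hp : g x.pt = y.pt) : galoisType x = galoisType y :=
  Quot.sound ⟨y.ext, g, StrongEmb.id _, hm, hp⟩

theorem restrict_surjective (hAP : K.AP) {M N : K.Model} (f : StrongEmb M N) :
    Function.Surjective (restrict f) := by
  intro q
  obtain ⟨x, rfl⟩ := exists_galoisType q
  obtain ⟨P, g₁, g₂, hg⟩ := hAP M x.ext N x.emb f
  exact ⟨galoisType ⟨P, g₂, g₁ x.pt⟩, (galoisType_eq_of_emb g₁ hg rfl).symm⟩

/-- Factoring a strong embedding through another one, by coherence. -/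
theorem StrongEmb.exists_factor {M N P : K.Model} (f : StrongEmb M P) (h : StrongEmb N P)
    (hle : ∀ x, ∃ y, h y = f x) : ∃ g : StrongEmb M N, h.comp g = f := by
  have hle' : f.toEmb.toHom.range ≤ h.toEmb.toHom.range := by
    rintro _ ⟨x, rfl⟩
    exact hle x
  let g : M ↪[L] N := h.toEmb.equivRange.symm.toEmbedding.comp
    ((Substructure.inclusion hle').comp f.toEmb.equivRange.toEmbedding)
  have hg : ∀ x, h.toEmb (g x) = f.toEmb x := fun x =>
    congrArg Subtype.val (h.toEmb.equivRange.apply_symm_apply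
      (Substructure.inclusion hle' (f.toEmb.equivRange x)))
  have hg' : h.toEmb.comp g = f.toEmb := DFunLike.ext _ _ hg
  refine ⟨⟨g, IsStrong.of_comp (g := h.toEmb) h.strong_range ?_⟩, StrongEmb.ext hg⟩
  rw [hg']
  exact f.strong_range

theorem isLSCardinal_LS (K : AEC L) : IsLSCardinal K.mem K.strong K.LS :=
  csInf_mem (s := {κ | IsLSCardinal K.mem K.strong κ}) K.exists_LS

theorem exists_sub {κ : Cardinal.{u}} (hκ : K.LS ≤ κ) (M : K.Model) (A : Set M) (hA : #A ≤ κ) :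
    ∃ N : Sub κ M, A ⊆ (N.1 : Set M) := by
  obtain ⟨S, hAS, hS, hc⟩ := (isLSCardinal_LS K).2 M M.isMem A
  refine ⟨⟨S, hS, hc.trans ?_⟩, hAS⟩
  exact (add_le_add hA hκ).trans (add_eq_self ((isLSCardinal_LS K).1.trans hκ)).le

/-- Realising `q` by the image of the given point, in an extension of its ambient model, lets
realisations of a chain of types form a chain of models with a fixed point. -/
theorem exists_point_extending (hAP : K.AP) {M N : K.Model} (f : StrongEmb M N) (x : Point M)
    (q : GaS N) (hq : restrict f q = galoisType x) : ∃ (y : Point N) (g : StrongEmb x.ext y.ext),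
      galoisType y = q ∧ (∀ m, g (x.emb m) = y.emb (f m)) ∧ g x.pt = y.pt := by
  obtain ⟨z, rfl⟩ := exists_galoisType q
  obtain ⟨P, g, h, hm, hp⟩ := (galoisType_eq_iff hAP).1 ((restrict_galoisType f z).symm.trans hq)
  exact ⟨⟨P, g.comp z.emb, h x.pt⟩, h, (galoisType_eq_of_emb g (fun _ => rfl) hp).symm,
    fun m => (hm m).symm, rfl⟩

/-- Unions of `ω`-chains of models: a common extension of a chain. -/
theorem exists_nat_union (M : ℕ → K.Model) (f : ∀ n, StrongEmb (M n) (M (n + 1))) :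
    ∃ (U : K.Model) (e : ∀ n, StrongEmb (M n) U), (∀ n, (e (n + 1)).comp (f n) = e n) ∧
      ∀ (W : K.Model) (k : ∀ n, StrongEmb (M n) W), (∀ n, (k (n + 1)).comp (f n) = k n) →
        ∃ d : StrongEmb U W, ∀ n, d.comp (e n) = k n := by
  let f' : ∀ n, M n ⟶ M (n + 1) := f
  let F : ℕ ⥤ K.Model := Functor.ofSequence f'
  have hF : ∀ n, F.map (homOfLE (Nat.le_add_right n 1)) = f' n :=
    Functor.ofSequence_map_homOfLE_succ f'
  refine ⟨colimit F, fun n => colimit.ι F n, fun n => ?_, fun W k hk => ?_⟩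
  · have := colimit.w F (homOfLE (Nat.le_add_right n 1))
    rwa [hF] at this
  · let s : Cocone F := ⟨W, NatTrans.ofSequence (fun n => k n) fun n => by
      rw [hF]
      exact (hk n).trans (Category.comp_id (X := M n) (k n)).symm⟩
    exact ⟨colimit.desc F s, fun n => colimit.ι_desc s n⟩

/-- An `ω`-chain of Galois types has an upper bound. -/
theorem exists_type_nat_chain (hAP : K.AP) (M : ℕ → K.Model)
    (f : ∀ n, StrongEmb (M n) (M (n + 1))) (q : ∀ n, GaS (M n))
    (hq : ∀ n, restrict (f n) (q (n + 1)) = q n) (W : K.Model) (k : ∀ n, StrongEmb (M n) W)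
    (hk : ∀ n, (k (n + 1)).comp (f n) = k n) : ∃ p : GaS W, ∀ n, restrict (k n) p = q n := by
  have step : ∀ n (x : {x : Point (M n) // galoisType x = q n}),
      ∃ (y : {y : Point (M (n + 1)) // galoisType y = q (n + 1)})
        (g : StrongEmb x.1.ext y.1.ext), (∀ m, g (x.1.emb m) = y.1.emb (f n m)) ∧
        g x.1.pt = y.1.pt := by
    rintro n ⟨x, hx⟩
    obtain ⟨y, g, h1, h2⟩ := exists_point_extending hAP (f n) x (q (n + 1)) ((hq n).trans hx.symm)
    exact ⟨⟨y, h1⟩, g, h2⟩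
  choose next g hg hgp using step
  obtain ⟨x₀, hx₀⟩ := exists_galoisType (q 0)
  let x : ∀ n, {x : Point (M n) // galoisType x = q n} :=
    fun n => Nat.rec ⟨x₀, hx₀⟩ (fun n y => next n y) n
  obtain ⟨U, e, he, hU⟩ := exists_nat_union M f
  obtain ⟨V, v, hv, -⟩ := exists_nat_union (fun n => (x n).1.ext) (fun n => g n (x n))
  obtain ⟨d, hd⟩ := hU W k hk
  obtain ⟨d', hd'⟩ := hU V (fun n => (v n).comp (x n).1.emb) fun n => StrongEmb.ext fun m => by
    have h := congrArg (fun t : StrongEmb (x n).1.ext V => t ((x n).1.emb m)) (hv n)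
    refine Eq.trans ?_ h
    exact congrArg (v (n + 1)) (hg n (x n) m).symm
  -- `U` is the union of the bases and `V` that of the ambient models. Amalgamating `W` and `V` over
  -- `U` puts the common point into an extension of `W`.
  obtain ⟨Q, a, b, hab⟩ := hAP U W V d d'
  have hpt : ∀ n, v n (x n).1.pt = v 0 (x 0).1.pt := by
    intro n
    induction n with
    | zero => rfl
    | succ n ih =>
      rw [← ih, ← hv n]
      exact congrArg (v (n + 1)) (hgp n (x n)).symm
  refine ⟨galoisType ⟨Q, a, b (v 0 (x 0).1.pt)⟩, fun n => ?_⟩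
  rw [← (x n).2]
  refine (galoisType_eq_of_emb (b.comp (v n)) (fun m => ?_) (congrArg b (hpt n))).symm
  have h1 := congrArg (fun t : StrongEmb (M n) V => t m) (hd' n)
  have h2 := congrArg (fun t : StrongEmb (M n) W => t m) (hd n)
  change b (v n ((x n).1.emb m)) = a (k n m)
  refine (congrArg b h1.symm).trans (Eq.trans ?_ (congrArg a h2))
  exact (hab _).symm


/-! ### The rank and unranked types -/

variable {κ : Cardinal.{u}}

theorem rankGE_zero (M : K.Model) (q : GaS M) : RankGE κ 0 M q := by
  unfold RankGE
  rw [Ordinal.limitRecOn_zero]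
  trivial

theorem rankGE_add_one (α : Ordinal.{u}) (M : K.Model) (q : GaS M) :
    RankGE κ (α + 1) M q ↔ ∃ (M' : K.Model) (f : StrongEmb M M'), Cardinal.lift.{u + 1} κ <
      #{q' : GaS M' // restrict f q' = q ∧
        ∀ N : Sub κ M', RankGE κ α N.model (restrict N.incl q')} := by
  unfold RankGE
  rw [Ordinal.limitRecOn_add_one]

theorem rankGE_limit {γ : Ordinal.{u}} (hγ : Order.IsSuccLimit γ) (M : K.Model) (q : GaS M) :
    RankGE κ γ M q ↔ ∀ β < γ, RankGE κ β M q := by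
  unfold RankGE
  rw [Ordinal.limitRecOn_limit _ _ _ _ hγ]

theorem RankGE.of_add_one_of_imp {α β : Ordinal.{u}} (h : ∀ (M : K.Model) (q : GaS M),
    RankGE κ α M q → RankGE κ β M q) {M : K.Model} {q : GaS M} (hq : RankGE κ (α + 1) M q) :
    RankGE κ (β + 1) M q := by
  rw [rankGE_add_one] at hq ⊢
  obtain ⟨M', f, hf⟩ := hq
  exact ⟨M', f, hf.trans_le (mk_subtype_mono fun q' hq' => ⟨hq'.1, fun N => h _ _ (hq'.2 N)⟩)⟩

theorem RankGE.mono {α β : Ordinal.{u}} (hβα : β ≤ α) {M : K.Model} {q : GaS M}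
    (hq : RankGE κ α M q) : RankGE κ β M q := by
  induction α using Ordinal.limitRecOn generalizing β M with
  | zero =>
    obtain rfl : β = 0 := le_antisymm hβα zero_le
    exact hq
  | add_one α ih =>
    induction β using Ordinal.limitRecOn with
    | zero => exact rankGE_zero M q
    | add_one β _ =>
      exact RankGE.of_add_one_of_imp (fun M q h => ih (by simpa using hβα) h) hq
    | limit β hβ ihβ =>
      rw [rankGE_limit hβ]
      exact fun γ hγ => ihβ γ hγ (hγ.le.trans hβα)
  | limit α hα ih =>
    rcases hβα.eq_or_lt with rfl | hlt
    · exact hq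
    · exact (rankGE_limit hα M q).1 hq β hlt

/-- At a successor the same witnesses work, since extensions of `q` also extend its restriction. -/
theorem RankGE.restrict {α : Ordinal.{u}} {M N : K.Model} (f : StrongEmb M N) {q : GaS N}
    (hq : RankGE κ α N q) : RankGE κ α M (restrict f q) := by
  induction α using Ordinal.limitRecOn with
  | zero => exact rankGE_zero _ _
  | add_one α _ =>
    rw [rankGE_add_one] at hq ⊢
    obtain ⟨M', g, hg⟩ := hq
    refine ⟨M', g.comp f, hg.trans_le (mk_subtype_mono fun q' hq' => ⟨?_, hq'.2⟩)⟩
    rw [← restrict_comp, hq'.1]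
  | limit α hα ih =>
    rw [rankGE_limit hα] at hq ⊢
    exact fun β hβ => ih β hβ (hq β hβ)

/-- A concrete presentation of a Galois type over a small model, on subsets of a fixed set `Λ`. -/
structure TypeCode (K : AEC L) (Λ : Type u) where
  /-- the universe of the ambient model -/
  univ : Set Λ
  /-- its structure -/
  [str : L.Structure univ]
  /-- it is in the class -/
  isMem : K.mem univ
  /-- the base -/
  base : L.Substructure univ
  /-- the base is a strong submodel -/
  strong : K.strong base
  /-- the point -/
  pt : univ

attribute [instance] TypeCode.str

namespace TypeCode

variable {Λ : Type u} (c : TypeCode K Λ)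

/-- The base of a code, as a model. -/
def model : K.Model := ⟨c.base, (K.mem_of_strong _ c.strong).2⟩

/-- The type presented by a code. -/
def type : GaS c.model := galoisType
  { ext := ⟨c.univ, c.isMem⟩
    emb := ⟨c.base.subtype, by
      have h : c.base.subtype.toHom.range = c.base := Substructure.range_subtype c.base
      exact h.symm ▸ c.strong⟩
    pt := c.pt }

end TypeCode

/-- The base and the point lie in a strong submodel of size at most `κ`, which is copied onto a
subset of `Λ`. As codes form a type in universe `u`, ordinals indexed by them have a supremum. -/
theorem exists_typeCode (hκ : K.LS ≤ κ) {Λ : Type u} (hΛ : #Λ = κ) {M : K.Model} (hM : #M ≤ κ)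
    (q : GaS M) : ∃ (c : TypeCode K Λ) (i : StrongEmb M c.model),
      Function.Surjective i ∧ restrict i c.type = q := by
  have hinf : ℵ₀ ≤ κ := (isLSCardinal_LS K).1.trans hκ
  obtain ⟨x, rfl⟩ := exists_galoisType q
  obtain ⟨N, hN⟩ := exists_sub hκ x.ext (Set.range x.emb ∪ {x.pt}) (by
    refine (mk_union_le _ _).trans (add_le_of_le hinf (mk_range_le.trans hM) ?_)
    rw [mk_singleton]
    exact one_le_aleph0.trans hinf)
  obtain ⟨g, hg⟩ := StrongEmb.exists_factor x.emb N.incl fun m =>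
    ⟨⟨x.emb m, hN (Or.inl ⟨m, rfl⟩)⟩, rfl⟩
  obtain ⟨j⟩ : Nonempty (N.1 ↪ Λ) := by
    rw [← Cardinal.le_def, hΛ]
    exact N.2.2
  let e : N.1 ≃ Set.range j := Equiv.ofInjective j j.injective
  let _ : L.Structure (Set.range j) := e.inducedStructure
  let e' : N.model ≃[L] Set.range j := e.inducedStructureEquiv
  have hmem : K.mem (Set.range j) := K.mem_iso e' N.model.isMem
  have he' := isStrong_equiv e' hmem
  have hs : K.IsStrong (e'.toEmbedding.comp g.toEmb) := he'.comp g.strong_range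
  let p : N.model := ⟨x.pt, hN (Or.inr rfl)⟩
  let c : TypeCode K Λ := ⟨Set.range j, hmem, _, hs, e' p⟩
  let r := (e'.toEmbedding.comp g.toEmb).equivRange
  refine ⟨c, ⟨r.toEmbedding, isStrong_equiv r c.model.isMem⟩, r.surjective, ?_⟩
  have h1 : galoisType x = galoisType ⟨N.model, g, p⟩ :=
    (galoisType_eq_of_emb (x := ⟨N.model, g, p⟩) (y := x) N.incl
      (fun m => congrArg (fun t : StrongEmb M x.ext => t m) hg) rfl).symm
  rw [h1]
  exact (galoisType_eq_of_emb (x := ⟨N.model, g, p⟩) (y := ⟨⟨Set.range j, hmem⟩, _, e' p⟩)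
    ⟨e'.toEmbedding, he'⟩ (fun m => rfl) rfl).symm

/-- There is an ordinal such that all types over models of cardinality at most `κ` with at least
this rank are unranked. -/
theorem exists_rank_bound (hκ : K.LS ≤ κ) : ∃ α₀ : Ordinal.{u}, ∀ (M : K.Model) (q : GaS M),
    #M ≤ κ → RankGE κ α₀ M q → ∀ α, RankGE κ α M q := by
  classical
  -- A rank that the code fails to have, if any. The default 0 is never used.
  let g : TypeCode K κ.out → Ordinal.{u} := fun c =>
    if h : ∃ α, ¬ RankGE κ α c.model c.type then h.choose else 0
  refine ⟨⨆ c, g c, fun M q hM hq α => ?_⟩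
  obtain ⟨c, i, hi, rfl⟩ := exists_typeCode hκ (mk_out κ) hM q
  refine RankGE.restrict i ?_
  by_contra hα
  have h : ∃ α, ¬ RankGE κ α c.model c.type := ⟨α, hα⟩
  have hgc : ¬ RankGE κ (g c) c.model c.type := by
    have : g c = h.choose := dif_pos h
    rw [this]
    exact h.choose_spec
  -- As `i` is onto, it has a strong inverse `j`, along which the rank bound passes back to the
  -- code.
  obtain ⟨j, hj⟩ := StrongEmb.exists_factor (StrongEmb.id c.model) i fun x => hi x
  refine hgc (RankGE.mono (Ordinal.le_iSup g c) ?_)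
  have h2 := hq.restrict j
  rwa [restrict_comp, hj, restrict_id] at h2

/-- A type is unranked if all its restrictions to small models have rank `∞`. -/
def Unranked (κ : Cardinal.{u}) {M : K.Model} (q : GaS M) : Prop := ∀ α, RankGE κ α M q

theorem mk_iUnion_le_of_le {ι α : Type u} {S : ι → Set α} (hκ : ℵ₀ ≤ κ) (hι : #ι ≤ κ)
    (hS : ∀ i, #(S i) ≤ κ) : #(⋃ i, S i) ≤ κ :=
  (mk_iUnion_le S).trans ((mul_le_mul' hι (ciSup_le' hS)).trans (mul_eq_self hκ).le)

/-- Over a small model, an unranked type has `κ` many unranked extensions to a small model. -/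
theorem Unranked.exists_splitting {χ : Cardinal.{u}} (hχ : K.LS ≤ χ) (hχκ : χ ≤ κ)
    (htame : K.Tame χ) {Λ : Type u} (hΛ : #Λ = κ) {M : K.Model} (hM : #M ≤ κ)
    {q : GaS M} (hq : Unranked κ q) :
    ∃ (M' : K.Model) (f : StrongEmb M M') (t : Λ → GaS M'), #M' ≤ κ ∧
      Function.Injective t ∧ ∀ i, restrict f (t i) = q ∧ Unranked κ (t i) := by
  have hκ := hχ.trans hχκ
  have hinf : ℵ₀ ≤ κ := (isLSCardinal_LS K).1.trans hκ
  obtain ⟨α₀, hα₀⟩ := exists_rank_bound (K := K) hκ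
  -- At rank α₀ + 1, the small restrictions of the extensions have rank at least α₀ and so are
  -- unranked.
  obtain ⟨P, f, hf⟩ := (rankGE_add_one α₀ M q).1 (hq (α₀ + 1))
  obtain ⟨s⟩ : Nonempty (Λ ↪ {q' : GaS P // restrict f q' = q ∧
      ∀ N : Sub κ P, RankGE κ α₀ N.model (restrict N.incl q')}) := by
    rw [← Cardinal.lift_mk_le', hΛ]
    exact hf.le.trans_eq (Cardinal.lift_id'.{u, u + 1} _).symm
  have hD : ∀ i j, ∃ D : Sub χ P, i ≠ j →
      restrict D.incl (s i).1 ≠ restrict D.incl (s j).1 := by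
    intro i j
    by_cases hij : i = j
    · obtain ⟨D, -⟩ := exists_sub hχ P ∅ (by simp)
      exact ⟨D, fun h => (h hij).elim⟩
    · obtain ⟨D, hD⟩ := htame P (s i).1 (s j).1 fun h => hij (s.injective (Subtype.ext h))
      exact ⟨D, fun _ => hD⟩
  choose D hD using hD
  -- `N` contains the image of `M` and a separating submodel for each pair of chosen types.
  obtain ⟨N, hN⟩ := exists_sub hκ P (Set.range f ∪ ⋃ ij : Λ × Λ, (D ij.1 ij.2).1) (by
    refine (mk_union_le _ _).trans (add_le_of_le hinf (mk_range_le.trans hM) ?_)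
    refine mk_iUnion_le_of_le hinf ?_ fun ij => (D ij.1 ij.2).2.2.trans hχκ
    rw [mk_prod, lift_id, hΛ]
    exact (mul_eq_self hinf).le)
  obtain ⟨g, hg⟩ := StrongEmb.exists_factor f N.incl fun m => ⟨⟨f m, hN (Or.inl ⟨m, rfl⟩)⟩, rfl⟩
  refine ⟨N.model, g, fun i => restrict N.incl (s i).1, N.2.2, fun i j hij => ?_, fun i => ⟨?_, ?_⟩⟩
  · by_contra hne
    obtain ⟨d, hd⟩ := StrongEmb.exists_factor (D i j).incl N.incl fun m =>
      ⟨⟨m.1, hN (Or.inr (Set.mem_iUnion.2 ⟨(i, j), m.2⟩))⟩, rfl⟩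
    apply hD i j hne
    rw [← hd, ← restrict_comp, ← restrict_comp]
    exact congrArg _ hij
  · rw [restrict_comp, hg]
    exact (s i).2.1
  · exact hα₀ _ _ N.2.2 ((s i).2.2 N)

/-- The rank over a large model is a minimum over small submodels, so a single restriction of
ordinal rank suffices. -/
theorem totallyTranscendental_of_not_unranked (hκ : K.LS ≤ κ)
    (h : ∀ (M : K.Model) (q : GaS M), #M ≤ κ → ¬ Unranked κ q) : K.TotallyTranscendental κ := by
  intro M q
  obtain ⟨N, -⟩ := exists_sub hκ M ∅ (by simp)
  obtain ⟨α, hα⟩ := not_forall.1 (h N.model (restrict N.incl q) N.2.2)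
  have h1 : smallRM κ N.model (restrict N.incl q) ≤ α := by
    apply csSup_le'
    rintro _ ⟨β, hβ, rfl⟩
    rw [WithTop.coe_le_coe]
    by_contra hlt
    exact hα (hβ.mono (not_le.1 hlt).le)
  have h2 : RM κ M q ≤ α := (ciInf_le' _ N).trans h1
  exact ⟨_, (WithTop.coe_untop _ (ne_top_of_le_ne_top WithTop.coe_ne_top h2)).symm⟩


/-! ### The tree of unranked types and the count of its branches -/

/-- Each child is amalgamated with `W` over its parent, and then the resulting extensions of `W` are
amalgamated over `W`. -/
theorem exists_tree_amalgam_step (hAP : K.AP) {Λ : Type u} (D : List Λ → K.Model)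
    (φ : ∀ i σ, StrongEmb (D σ) (D (i :: σ))) (n : ℕ) (W : K.Model)
    (e : ∀ σ : List Λ, σ.length = n → StrongEmb (D σ) W) :
    ∃ (W' : K.Model) (e' : ∀ σ : List Λ, σ.length = n + 1 → StrongEmb (D σ) W')
      (g : StrongEmb W W'), ∀ i σ (h : σ.length = n),
        (e' (i :: σ) (congrArg (· + 1) h)).comp (φ i σ) = g.comp (e σ h) := by
  have h1 : ∀ s : Λ × {σ : List Λ // σ.length = n}, ∃ (N : K.Model) (a : StrongEmb W N)
      (b : StrongEmb (D (s.1 :: s.2.1)) N), ∀ x, a (e s.2.1 s.2.2 x) = b (φ s.1 s.2.1 x) :=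
    fun s => hAP _ _ _ _ _
  choose N a b hab using h1
  obtain ⟨P, h, g, hg⟩ := exists_amalgam_family hAP N a
  refine ⟨P, fun σ => match σ with
    | [] => fun hσ => absurd hσ (by simp)
    | i :: ρ => fun hσ => (g (i, ⟨ρ, Nat.succ_injective hσ⟩)).comp (b (i, ⟨ρ, Nat.succ_injective hσ⟩)),
    h, fun i σ hσ => StrongEmb.ext fun x => ?_⟩
  change g (i, ⟨σ, hσ⟩) (b (i, ⟨σ, hσ⟩) (φ i σ x)) = h (e σ hσ x)
  rw [← hab (i, ⟨σ, hσ⟩), hg]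

/-- Amalgamation of a tree of models of height `ω`. -/
theorem exists_tree_amalgam (hAP : K.AP) {Λ : Type u} (D : List Λ → K.Model)
    (φ : ∀ i σ, StrongEmb (D σ) (D (i :: σ))) : ∃ (W : K.Model) (e : ∀ σ, StrongEmb (D σ) W),
      ∀ i σ, (e (i :: σ)).comp (φ i σ) = e σ := by
  let Stage : ℕ → Type (u + 1) := fun n =>
    Σ W : K.Model, ∀ σ : List Λ, σ.length = n → StrongEmb (D σ) W
  have step : ∀ n (x : Stage n), ∃ (y : Stage (n + 1)) (g : StrongEmb x.1 y.1),
      ∀ i σ (h : σ.length = n),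
        (y.2 (i :: σ) (congrArg (· + 1) h)).comp (φ i σ) = g.comp (x.2 σ h) := by
    rintro n ⟨W, e⟩
    obtain ⟨W', e', g, h⟩ := exists_tree_amalgam_step hAP D φ n W e
    exact ⟨⟨W', e'⟩, g, h⟩
  choose next g hg using step
  let x : ∀ n, Stage n := fun n => Nat.rec
    ⟨D [], fun σ h => match σ, h with | [], _ => StrongEmb.id _⟩ (fun n y => next n y) n
  obtain ⟨U, k, hk, -⟩ := exists_nat_union (fun n => (x n).1) (fun n => g n (x n))
  refine ⟨U, fun σ => (k σ.length).comp ((x σ.length).2 σ rfl), fun i σ => ?_⟩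
  refine Eq.trans ?_ (congrArg (fun t => StrongEmb.comp t ((x σ.length).2 σ rfl)) (hk σ.length))
  refine StrongEmb.ext fun m => ?_
  exact congrArg (fun t : StrongEmb (D σ) (x (σ.length + 1)).1 => k (σ.length + 1) (t m))
    (hg _ (x σ.length) i σ rfl)

/-- An unranked type over a small model. -/
structure UnrankedNode (K : AEC L) (κ : Cardinal.{u}) where
  /-- the model -/
  model : K.Model
  /-- it is small -/
  card_le : #model ≤ κ
  /-- the type -/
  type : GaS model
  /-- it is unranked -/
  unranked : Unranked κ type

/-- The restriction of a sequence to its first `n` terms, the last one first. -/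
def branch {Λ : Type u} (τ : ℕ → Λ) : ℕ → List Λ
  | 0 => []
  | n + 1 => τ n :: branch τ n

/-- An unranked type yields a small model with many types. -/
theorem exists_many_types (hAP : K.AP) {χ : Cardinal.{u}} (hχ : K.LS ≤ χ) (hχκ : χ ≤ κ)
    (htame : K.Tame χ) {Λ : Type u} (hΛ : #Λ = κ) (r : UnrankedNode K κ) :
    ∃ (N : K.Model) (p : (ℕ → Λ) → GaS N), #N ≤ κ ∧ Function.Injective p := by
  have hκ := hχ.trans hχκ
  have hinf : ℵ₀ ≤ κ := (isLSCardinal_LS K).1.trans hκ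
  choose M' f t hM' ht htq using fun v : UnrankedNode K κ =>
    Unranked.exists_splitting hχ hχκ htame hΛ v.card_le v.unranked
  -- All children of a node `v` have the same model `M' v` and differ only in the type. Hence the
  -- type at `i :: σ` lives over `D σ`, and siblings can be compared there.
  let node : List Λ → UnrankedNode K κ := fun σ =>
    List.rec r (fun i _ v => ⟨M' v, hM' v, t v i, (htq v i).2⟩) σ
  let D : List Λ → K.Model := fun σ => M' (node σ)
  obtain ⟨W, e, he⟩ := exists_tree_amalgam hAP D (fun i σ => f (node (i :: σ)))
  have hp : ∀ τ : ℕ → Λ, ∃ p : GaS W, ∀ n,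
      restrict (e (branch τ n)) p = t (node (branch τ n)) (τ n) := fun τ =>
    exists_type_nat_chain hAP (fun n => D (branch τ n)) (fun n => f (node (branch τ (n + 1))))
      (fun n => t (node (branch τ n)) (τ n)) (fun n => (htq (node (branch τ (n + 1))) _).1) W
      (fun n => e (branch τ n)) (fun n => he (τ n) (branch τ n))
  choose p hp using hp
  have : Infinite Λ := by rwa [Cardinal.infinite_iff, hΛ]
  -- There are only `κ` finite sequences, so all nodes fit in a model of size at most `κ`.
  obtain ⟨N, hN⟩ := exists_sub hκ W (⋃ σ, Set.range (e σ)) (mk_iUnion_le_of_le hinf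
    (by rw [mk_list_eq_mk, hΛ]) fun σ => mk_range_le.trans (hM' _))
  have hd : ∀ σ, ∃ d : StrongEmb (D σ) N.model, N.incl.comp d = e σ := fun σ =>
    StrongEmb.exists_factor _ _ fun x => ⟨⟨e σ x, hN (Set.mem_iUnion.2 ⟨σ, x, rfl⟩)⟩, rfl⟩
  choose d hd using hd
  refine ⟨N.model, fun τ => restrict N.incl (p τ), N.2.2, fun τ τ' h => ?_⟩
  -- At a common node both types restrict to members of the same injective family.
  have hstep : ∀ n, branch τ n = branch τ' n → τ n = τ' n := by
    intro n hn
    have h1 := hp τ n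
    rw [hn] at h1
    have h2 := hp τ' n
    rw [← hd, ← restrict_comp] at h1 h2
    exact ht _ (h1.symm.trans ((congrArg _ h).trans h2))
  have hbr : ∀ n, branch τ n = branch τ' n := by
    intro n
    induction n with
    | zero => rfl
    | succ n ih => exact congrArg₂ List.cons (hstep n ih) ih
  exact funext fun n => hstep n (hbr n)

/-- If there are at least `κ` types over a small model, it has an extension of cardinality `κ`. -/
theorem exists_extension_card_eq (hAP : K.AP) (hκ : K.LS ≤ κ) {Λ : Type u} (hΛ : #Λ = κ)
    {N : K.Model} (hN : #N ≤ κ) (p : Λ → GaS N) (hp : Function.Injective p) :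
    ∃ (M : K.Model) (_ : StrongEmb N M), #M = κ := by
  have hinf : ℵ₀ ≤ κ := (isLSCardinal_LS K).1.trans hκ
  choose x hx using fun i => exists_galoisType (p i)
  obtain ⟨P, h, g, hg⟩ := exists_amalgam_family hAP (fun i => (x i).ext) (fun i => (x i).emb)
  -- Realisations of distinct types in a common extension are distinct elements.
  have hinj : Function.Injective fun i => g i (x i).pt := by
    intro i j hij
    apply hp
    rw [← hx i, ← hx j]
    exact Quot.sound ⟨P, g i, g j, fun m => (hg i m).trans (hg j m).symm, hij⟩
  obtain ⟨S, hS⟩ := exists_sub hκ P (Set.range h ∪ Set.range fun i => g i (x i).pt)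
    ((mk_union_le _ _).trans (add_le_of_le hinf (mk_range_le.trans hN)
      (mk_range_le.trans hΛ.le)))
  obtain ⟨d, -⟩ := StrongEmb.exists_factor h S.incl fun m => ⟨⟨h m, hS (Or.inl ⟨m, rfl⟩)⟩, rfl⟩
  refine ⟨S.model, d, le_antisymm S.2.2 ?_⟩
  refine hΛ.ge.trans (mk_le_of_injective (f := fun i => (⟨g i (x i).pt, hS (Or.inr ⟨i, rfl⟩)⟩ : S.1))
    fun i j hij => hinj (congrArg Subtype.val hij))

end AEC

theorem theorem4p4 {L : FirstOrder.Language.{u, u}} (K : AEC L) (hAP : K.AP) (hJEP : K.JEP)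
    (χ lam : Cardinal.{u}) (hχ : K.LS ≤ χ) (htame : K.Tame χ) (hχlam : χ ≤ lam)
    (hstable : K.Stable lam) (hpow : lam < lam ^ (ℵ₀ : Cardinal.{u})) :
    K.TotallyTranscendental lam := by
  have hκ := hχ.trans hχlam
  refine AEC.totallyTranscendental_of_not_unranked hκ fun M q hM hq => ?_
  obtain ⟨Λ, hΛ⟩ : ∃ Λ : Type u, #Λ = lam := ⟨lam.out, mk_out lam⟩
  obtain ⟨N, p, hN, hp⟩ := AEC.exists_many_types hAP hχ hχlam htame hΛ ⟨M, hM, q, hq⟩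
  -- Stability concerns models of size exactly `lam`, while `N` may be smaller. The constant
  -- sequences supply `lam` distinct types for the enlargement.
  obtain ⟨P, f, hP⟩ := AEC.exists_extension_card_eq hAP hκ hΛ hN (fun i => p fun _ => i)
    fun i j hij => congrFun (hp hij) 0
  -- Every type over `N` extends to `P`, so `P` has at least as many types.
  choose s hs using fun τ => AEC.restrict_surjective hAP f (p τ)
  have hinj : Function.Injective s := fun τ τ' h => hp (by rw [← hs τ, ← hs τ', h])
  have h1 := lift_mk_le_lift_mk_of_injective hinj
  rw [hstable P hP] at h1
  have h2 : #(ℕ → Λ) = lam ^ (ℵ₀ : Cardinal.{u}) := by simp [hΛ]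
  rw [h2, Cardinal.lift_id'.{u, u + 1}, lift_le] at h1
  exact h1.not_gt hpow
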